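/- For $n\ge 1$, a Stirling permutation of order $n$ is an arrangement $\sigma=\sigma_1\sigma_2\cdots\sigma_{2n}$ of the multiset $\{1,1,2,2,\ldots,n,n\}$ such that, for each $i\in\{1,\dots,n\}$, every entry standing between the two occurrences of $i$ is greater than $i$. For a permutation $\tau=\tau_1\cdots\tau_k$ of $\{1,\dots,k\}$, say that $\sigma$ contains $\tau$ if there are indices $1\le i_1<\cdots<i_k\le 2n$ with $\sigma_{i_s}<\sigma_{i_t}$ whenever $\tau_s<\tau_t$, and that $\sigma$ avoids $\tau$ otherwise. Let $\mathcal{Q}_n(\tau)$ be the set of Stirling permutations of order $n$ that avoid $\tau$. Let $\mathrm{des}(\sigma)$, $\mathrm{asc}(\sigma)$ and $\mathrm{plat}(\sigma)$ be the numbers of indices $1\le i\le 2n-1$ with $\sigma_i>\sigma_{i+1}$, $\sigma_i<\sigma_{i+1}$ and $\sigma_i=\sigma_{i+1}$, respectively. Then, for every $n\ge 1$, the following identities of polynomials in $q$ hold: $$\sum_{\sigma\in\mathcal{Q}_n(123)}q^{\mathrm{des}(\sigma)+1}=\sum_{\sigma\in\mathcal{Q}_n(123)}q^{\mathrm{plat}(\sigma)},$$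 $$\sum_{\sigma\in\mathcal{Q}_n(213)}q^{\mathrm{asc}(\sigma)+1}=\sum_{\sigma\in\mathcal{Q}_n(213)}q^{\mathrm{des}(\sigma)+1}=\sum_{\sigma\in\mathcal{Q}_n(213)}q^{\mathrm{plat}(\sigma)}.$$ That is, $\mathrm{des}+1$ and $\mathrm{plat}$ are equidistributed on $\mathcal{Q}_n(123)$, and $\mathrm{asc}+1$, $\mathrm{des}+1$ and $\mathrm{plat}$ are equidistributed on $\mathcal{Q}_n(213)$. -/

import Mathlib

namespace StirlingPerm

/-- The word `1 1 2 2 ⋯ n n`, listing the multiset `{1, 1, 2, 2, …, n, n}`. -/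
def doubledWord (n : ℕ) : List ℕ :=
  (List.range n).flatMap fun i => [i + 1, i + 1]

/-- Every entry of the word `σ` standing between two occurrences of a letter is greater than
that letter. -/
def StirlingCondition (σ : List ℕ) : Prop :=
  ∀ i j k : Fin σ.length, i < j → j < k → σ.get i = σ.get k → σ.get i < σ.get j

/-- The word `σ` contains the pattern `τ = τ₁ τ₂ ⋯ τₖ`: there are positions
`f 1 < f 2 < ⋯ < f k` of `σ` such that `σ (f s) < σ (f t)` whenever `τ s < τ t`. -/
def ContainsPattern {k : ℕ} (τ : Fin k → ℕ) (σ : List ℕ) : Prop :=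
  ∃ f : Fin k → Fin σ.length, (∀ s t, s < t → f s < f t) ∧
    ∀ s t, τ s < τ t → σ.get (f s) < σ.get (f t)

open Classical in
/-- The Stirling permutations of order `n` (arrangements of the multiset `{1, 1, …, n, n}`
satisfying the Stirling condition), as a finite set of words. -/
noncomputable def stirlingPerms (n : ℕ) : Finset (List ℕ) :=
  (doubledWord n).permutations.toFinset.filter fun σ => StirlingCondition σ

open Classical in
/-- The Stirling permutations of order `n` avoiding the pattern `τ`. -/
noncomputable def stirlingAvoiding (n : ℕ) {k : ℕ} (τ : Fin k → ℕ) : Finset (List ℕ) :=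
  (stirlingPerms n).filter fun σ => ¬ ContainsPattern τ σ

theorem mem_stirlingPerms {n : ℕ} {σ : List ℕ} :
    σ ∈ stirlingPerms n ↔ σ.Perm (doubledWord n) ∧ StirlingCondition σ := by
  simp [stirlingPerms]

theorem mem_stirlingAvoiding {n k : ℕ} {τ : Fin k → ℕ} {σ : List ℕ} :
    σ ∈ stirlingAvoiding n τ ↔
      (σ.Perm (doubledWord n) ∧ StirlingCondition σ) ∧ ¬ ContainsPattern τ σ := by
  simp [stirlingAvoiding, mem_stirlingPerms]

/-- Number of descents: pairs of consecutive entries `(σᵢ, σᵢ₊₁)` with `σᵢ > σᵢ₊₁`. -/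
def des (σ : List ℕ) : ℕ := (σ.zip σ.tail).countP fun p => p.1 > p.2

/-- Number of ascents: pairs of consecutive entries `(σᵢ, σᵢ₊₁)` with `σᵢ < σᵢ₊₁`. -/
def asc (σ : List ℕ) : ℕ := (σ.zip σ.tail).countP fun p => p.1 < p.2

/-- Number of plateaus: pairs of consecutive entries `(σᵢ, σᵢ₊₁)` with `σᵢ = σᵢ₊₁`. -/
def plat (σ : List ℕ) : ℕ := (σ.zip σ.tail).countP fun p => p.1 = p.2

end StirlingPerm

namespace StirlingPerm

open scoped List

/-! ### Words and three-letter subwords -/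

/-! Pattern 213. Cut a word at the two copies of its smallest letter `x`, as `A x B x C`. A letter
`y` before some `x` and a letter `z` after it satisfy `z ≤ y` (else `y x z` is a 213) and `z ≠ y`
(else `y x y` breaks the Stirling condition). So every letter of `A` exceeds every letter of `B`,
and these exceed those of `C`; the three blocks use consecutive intervals of letters and are
otherwise independent. Recursively this codes words by ternary trees (`bijOn_word`), and `asc + 1`,
`des + 1`, `plat` count left, right and middle leaves (`asc_word`, `des_word`, `plat_word`).
Permuting children everywhere gives the equidistributions.

Pattern 123. The two copies of the largest letter are adjacent, and what precedes them must be
weakly decreasing. Words of order `n + 1` thus arise from words of order `n` by inserting a pair at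
a position of the initial weakly decreasing run (`sum_stirlingAvoiding_123_succ`). Insertion at the
front or into the ascent ending the run raises both statistics by one. Inside the run plateaus and
descents alternate: splitting a plateau raises only `des`, splitting a descent or appending at the
end raises only `plat`. The new run length depends only on the old one and the position, so the
generating function obeys a recursion in which passing from `des + 1` to `plat` exchanges the
weights `X` and `1` (`sum_pow_stat`). Its invariance under this exchange is `insertionPoly_symm`. -/

/-- Stirling condition in terms of subwords. -/
def IsStirling (l : List ℕ) : Prop := ∀ a b, [a, b, a] <+ l → a < b

theorem triple_sublist_iff {a b c : ℕ} {l : List ℕ} :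
    [a, b, c] <+ l ↔ ∃ i j k : Fin l.length, i < j ∧ j < k ∧
      l.get i = a ∧ l.get j = b ∧ l.get k = c := by
  rw [List.sublist_iff_exists_fin_orderEmbedding_get_eq]
  constructor
  · rintro ⟨f, hf⟩
    refine ⟨f ⟨0, by simp⟩, f ⟨1, by simp⟩, f ⟨2, by simp⟩, ?_, ?_, ?_, ?_, ?_⟩
    · simp
    · simp
    · simpa using (hf ⟨0, by simp⟩).symm
    · simpa using (hf ⟨1, by simp⟩).symm
    · simpa using (hf ⟨2, by simp⟩).symm
  · rintro ⟨i, j, k, hij, hjk, ha, hb, hc⟩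
    have hm : StrictMono (![i, j, k] : Fin 3 → Fin l.length) := by
      rw [Fin.strictMono_iff_lt_succ]
      intro s
      fin_cases s
      · exact hij
      · exact hjk
    refine ⟨OrderEmbedding.ofStrictMono (![i, j, k] : Fin 3 → Fin l.length) hm, ?_⟩
    intro s
    change Fin 3 at s
    fin_cases s
    · exact ha.symm
    · exact hb.symm
    · exact hc.symm

theorem stirlingCondition_iff {l : List ℕ} : StirlingCondition l ↔ IsStirling l := by
  constructor
  · intro h a b hs
    obtain ⟨i, j, k, hij, hjk, ha, hb, hc⟩ := triple_sublist_iff.1 hs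
    have := h i j k hij hjk (ha.trans hc.symm)
    rwa [ha, hb] at this
  · intro h i j k hij hjk hik
    exact h _ _ (triple_sublist_iff.2 ⟨i, j, k, hij, hjk, rfl, rfl, hik.symm⟩)

theorem containsPattern_123_iff {l : List ℕ} :
    ContainsPattern ![1, 2, 3] l ↔ ∃ a b c, a < b ∧ b < c ∧ [a, b, c] <+ l := by
  constructor
  · rintro ⟨f, hf, h⟩
    exact ⟨_, _, _, h 0 1 (by simp), h 1 2 (by simp), triple_sublist_iff.2
      ⟨f 0, f 1, f 2, hf _ _ (by decide), hf _ _ (by decide), rfl, rfl, rfl⟩⟩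
  · rintro ⟨a, b, c, hab, hbc, hs⟩
    obtain ⟨i, j, k, hij, hjk, rfl, rfl, rfl⟩ := triple_sublist_iff.1 hs
    refine ⟨![i, j, k], ?_, ?_⟩
    · intro s t hst
      have := hij.trans hjk
      fin_cases s <;> fin_cases t <;> simp_all
    · intro s t hst
      have := hab.trans hbc
      fin_cases s <;> fin_cases t <;> simp_all

theorem containsPattern_213_iff {l : List ℕ} :
    ContainsPattern ![2, 1, 3] l ↔ ∃ a b c, a < b ∧ b < c ∧ [b, a, c] <+ l := by
  constructor
  · rintro ⟨f, hf, h⟩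
    exact ⟨_, _, _, h 1 0 (by simp), h 0 2 (by simp), triple_sublist_iff.2
      ⟨f 0, f 1, f 2, hf _ _ (by decide), hf _ _ (by decide), rfl, rfl, rfl⟩⟩
  · rintro ⟨a, b, c, hab, hbc, hs⟩
    obtain ⟨i, j, k, hij, hjk, rfl, rfl, rfl⟩ := triple_sublist_iff.1 hs
    refine ⟨![i, j, k], ?_, ?_⟩
    · intro s t hst
      have := hij.trans hjk
      fin_cases s <;> fin_cases t <;> simp_all
    · intro s t hst
      have := hab.trans hbc
      fin_cases s <;> fin_cases t <;> simp_all

theorem count_doubledWord (n y : ℕ) :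
    (doubledWord n).count y = if 0 < y ∧ y ≤ n then 2 else 0 := by
  induction n with
  | zero => simp [doubledWord]; omega
  | succ n ih =>
    have : doubledWord (n + 1) = doubledWord n ++ [n + 1, n + 1] := by
      simp [doubledWord, List.range_succ]
    rw [this, List.count_append, ih]
    by_cases h : y = n + 1
    · subst h; simp
    · have : ([n + 1, n + 1] : List ℕ).count y = 0 := by
        rw [List.count_eq_zero]; simpa using h
      rw [this]
      split_ifs <;> omega

theorem perm_doubledWord_iff {n : ℕ} {l : List ℕ} :
    l.Perm (doubledWord n) ↔ ∀ y, l.count y = if 0 < y ∧ y ≤ n then 2 else 0 := by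
  rw [List.perm_iff_count]
  simp only [count_doubledWord]

theorem pair_sublist_append {b c : ℕ} {l₁ l₂ : List ℕ} :
    [b, c] <+ l₁ ++ l₂ ↔ [b, c] <+ l₁ ∨ (b ∈ l₁ ∧ c ∈ l₂) ∨ [b, c] <+ l₂ := by
  induction l₁ with
  | nil => simp
  | cons x l₁ ih =>
    simp only [List.cons_append, List.cons_sublist_cons', ih, List.singleton_sublist,
      List.mem_append, List.mem_cons]
    tauto

theorem triple_sublist_append {a b c : ℕ} {l₁ l₂ : List ℕ} :
    [a, b, c] <+ l₁ ++ l₂ ↔ [a, b, c] <+ l₁ ∨ ([a, b] <+ l₁ ∧ c ∈ l₂) ∨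
      (a ∈ l₁ ∧ [b, c] <+ l₂) ∨ [a, b, c] <+ l₂ := by
  induction l₁ with
  | nil => simp
  | cons x l₁ ih =>
    simp only [List.cons_append, List.cons_sublist_cons', ih, List.singleton_sublist,
      List.mem_cons, pair_sublist_append]
    grind

theorem mem_of_pair_sublist {a b : ℕ} {l : List ℕ} (h : [a, b] <+ l) : a ∈ l ∧ b ∈ l :=
  ⟨h.subset (by simp), h.subset (by simp)⟩

theorem mem_of_triple_sublist {a b c : ℕ} {l : List ℕ} (h : [a, b, c] <+ l) :
    a ∈ l ∧ b ∈ l ∧ c ∈ l :=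
  ⟨h.subset (by simp), h.subset (by simp), h.subset (by simp)⟩

/-- The cut at the first `x` is unique. This gives injectivity both of the tree coding and of the
insertion of a largest pair. -/
theorem append_cons_inj {x : ℕ} {u v u' v' : List ℕ} (hu : x ∉ u) (hu' : x ∉ u')
    (h : u ++ x :: v = u' ++ x :: v') : u = u' ∧ v = v' := by
  induction u generalizing u' with
  | nil =>
    cases u' with
    | nil => simpa using h
    | cons b u' =>
      simp only [List.nil_append, List.cons_append, List.cons.injEq] at h
      simp [h.1] at hu'
  | cons a u ih =>
    cases u' with
    | nil =>
      simp only [List.nil_append, List.cons_append, List.cons.injEq] at h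
      simp [h.1] at hu
    | cons b u' =>
      simp only [List.cons_append, List.cons.injEq] at h
      have := ih (fun hx => hu (by simp [hx])) (fun hx => hu' (by simp [hx])) h.2
      exact ⟨by rw [h.1, this.1], this.2⟩

/-! ### Statistics on consecutive letters -/

/-- The number of consecutive pairs of letters of a word related by `r`. -/
def adj (r : ℕ → ℕ → Bool) (l : List ℕ) : ℕ := (l.zip l.tail).countP fun p => r p.1 p.2

@[simp] theorem adj_nil (r : ℕ → ℕ → Bool) : adj r [] = 0 := rfl

@[simp] theorem adj_singleton (r : ℕ → ℕ → Bool) (a : ℕ) : adj r [a] = 0 := rfl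

@[simp] theorem adj_cons_cons (r : ℕ → ℕ → Bool) (a b : ℕ) (l : List ℕ) :
    adj r (a :: b :: l) = (if r a b then 1 else 0) + adj r (b :: l) := by
  simp only [adj, List.tail_cons, List.zip_cons_cons, List.countP_cons]
  omega

theorem adj_append_cons (r : ℕ → ℕ → Bool) (u : List ℕ) (x : ℕ) (v : List ℕ) :
    adj r (u ++ x :: v) = adj r (u ++ [x]) + adj r (x :: v) := by
  induction u with
  | nil => simp
  | cons a u ih =>
    cases u with
    | nil => simp
    | cons b u =>
      simp only [List.cons_append, adj_cons_cons] at ih ⊢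
      omega

/-- When `x` is extremal among the letters involved, the comparison at the junction does not depend
on the last letter of `u`, only on whether there is one. -/
theorem adj_concat {r : ℕ → ℕ → Bool} {b : Bool} {u : List ℕ} {x : ℕ} (h : ∀ y ∈ u, r y x = b) :
    adj r (u ++ [x]) = adj r u + if u = [] then 0 else b.toNat := by
  induction u with
  | nil => simp
  | cons a u ih =>
    cases u with
    | nil => cases b <;> simp_all
    | cons c u =>
      have := ih (fun y hy => h y (by simp [hy]))
      simp only [List.cons_append, adj_cons_cons] at this ⊢
      simp at this ⊢
      omega

theorem adj_cons {r : ℕ → ℕ → Bool} {b : Bool} {u : List ℕ} {x : ℕ} (h : ∀ y ∈ u, r x y = b) :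
    adj r (x :: u) = adj r u + if u = [] then 0 else b.toNat := by
  cases u with
  | nil => simp
  | cons c u =>
    have := h c (by simp)
    cases b <;> simp [this, add_comm]

theorem des_eq_adj (l : List ℕ) : des l = adj (fun a b => decide (a > b)) l := rfl

theorem asc_eq_adj (l : List ℕ) : asc l = adj (fun a b => decide (a < b)) l := rfl

theorem plat_eq_adj (l : List ℕ) : plat l = adj (fun a b => decide (a = b)) l := rfl

end StirlingPerm

namespace StirlingPerm

open scoped List

/-! ### Words avoiding 213 and ternary trees -/

/-- Ternary trees. -/
inductive TernaryTree : Type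
  | leaf : TernaryTree
  | node (a b c : TernaryTree) : TernaryTree

namespace TernaryTree

/-- The number of inner nodes. -/
def size : TernaryTree → ℕ
  | leaf => 0
  | node a b c => a.size + b.size + c.size + 1

/-- The 213-avoiding Stirling word on the letters `m + 1, …, m + size` coded by a tree. -/
def word : ℕ → TernaryTree → List ℕ
  | _, leaf => []
  | m, node a b c => word (m + 1 + c.size + b.size) a ++
      (m + 1) :: (word (m + 1 + c.size) b ++ (m + 1) :: word (m + 1) c)

/-- The number of leaves that are a left child. -/
def leftLeaves : TernaryTree → ℕ
  | leaf => 0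
  | node a b c => (match a with | leaf => 1 | _ => a.leftLeaves) + b.leftLeaves + c.leftLeaves

/-- The number of leaves that are a middle child. -/
def midLeaves : TernaryTree → ℕ
  | leaf => 0
  | node a b c => a.midLeaves + (match b with | leaf => 1 | _ => b.midLeaves) + c.midLeaves

/-- The number of leaves that are a right child. -/
def rightLeaves : TernaryTree → ℕ
  | leaf => 0
  | node a b c => a.rightLeaves + b.rightLeaves + (match c with | leaf => 1 | _ => c.rightLeaves)

/-- Exchange left and right children everywhere. -/
def swapLR : TernaryTree → TernaryTree
  | leaf => leaf
  | node a b c => node c.swapLR b.swapLR a.swapLR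

/-- Exchange middle and right children everywhere. -/
def swapMR : TernaryTree → TernaryTree
  | leaf => leaf
  | node a b c => node a.swapMR c.swapMR b.swapMR

theorem swapLR_swapLR (t : TernaryTree) : t.swapLR.swapLR = t := by
  induction t <;> simp_all [swapLR]

theorem swapMR_swapMR (t : TernaryTree) : t.swapMR.swapMR = t := by
  induction t <;> simp_all [swapMR]

theorem size_swapLR (t : TernaryTree) : t.swapLR.size = t.size := by
  induction t <;> simp_all [swapLR, size]; omega

theorem size_swapMR (t : TernaryTree) : t.swapMR.size = t.size := by
  induction t <;> simp_all [swapMR, size]; omega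

theorem rightLeaves_swapLR (t : TernaryTree) : t.swapLR.rightLeaves = t.leftLeaves := by
  induction t with
  | leaf => rfl
  | node a b c iha ihb ihc =>
    cases a <;> simp_all [swapLR, rightLeaves, leftLeaves] <;> omega

theorem rightLeaves_swapMR (t : TernaryTree) : t.swapMR.rightLeaves = t.midLeaves := by
  induction t with
  | leaf => rfl
  | node a b c iha ihb ihc =>
    cases b <;> simp_all [swapMR, rightLeaves, midLeaves] <;> omega

theorem count_word (t : TernaryTree) : ∀ m y,
    (word m t).count y = if m < y ∧ y ≤ m + t.size then 2 else 0 := by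
  induction t with
  | leaf => intro m y; simp [word, size]
  | node a b c iha ihb ihc =>
    intro m y
    simp only [word, size, List.count_append, List.count_cons, iha, ihb, ihc, beq_iff_eq]
    grind

theorem mem_word {t : TernaryTree} {m y : ℕ} : y ∈ word m t ↔ m < y ∧ y ≤ m + t.size := by
  rw [← List.count_pos_iff, count_word]
  split_ifs <;> simp_all

theorem word_eq_nil {t : TernaryTree} {m : ℕ} : word m t = [] ↔ t = leaf := by
  cases t <;> simp [word]

theorem word_injective (t : TernaryTree) : ∀ m t', word m t = word m t' → t = t' := by
  induction t with
  | leaf => intro m t' h; exact (word_eq_nil.1 h.symm).symm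
  | node a b c iha ihb ihc =>
    intro m t' h
    cases t' with
    | leaf => simp [word] at h
    | node a' b' c' =>
      simp only [word] at h
      have hm : ∀ k t, m + 1 ∉ word (m + 1 + k) t := fun k t ht => by
        have := mem_word.1 ht
        omega
      obtain ⟨ha, h⟩ := append_cons_inj (by rw [add_assoc]; exact hm _ _)
        (by rw [add_assoc]; exact hm _ _) h
      obtain ⟨hb, hc⟩ := append_cons_inj (hm _ _) (hm _ _) h
      obtain rfl := ihc _ _ hc
      obtain rfl := ihb _ _ hb
      obtain rfl := iha _ _ ha
      rfl

/-- A nonempty middle or right block is entered by an ascent from the minimum, which supplies the `+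
1` of its inductive count. The left block is entered by no ascent; its missing unit is the global `+
1`, or the left leaf if the block is empty. -/
theorem asc_word (t : TernaryTree) : ∀ m, t ≠ leaf → asc (word m t) + 1 = t.leftLeaves := by
  simp only [asc_eq_adj]
  induction t with
  | leaf => simp
  | node a b c iha ihb ihc =>
    intro m _
    rw [word, adj_append_cons, adj_concat (b := false)
      (by intro y hy; have := mem_word.1 hy; simp; omega), ← List.cons_append, adj_append_cons,
      adj_cons (b := true) (u := word (m + 1) c)
      (by intro y hy; have := mem_word.1 hy; simp; omega)]
    have hb : adj (fun a b => decide (a < b)) ((m + 1) :: word (m + 1 + c.size) b ++ [m + 1])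
        = b.leftLeaves := by
      rcases eq_or_ne b leaf with rfl | hb
      · simp [word, leftLeaves]
      · have h := ihb (m + 1 + c.size) hb
        rw [adj_concat (b := false)
          (by intro y hy; rw [List.mem_cons, mem_word] at hy; simp; omega), adj_cons (b := true)
          (by intro y hy; have := mem_word.1 hy; simp; omega)]
        simp [word_eq_nil, hb, h]
    have hc : adj (fun a b => decide (a < b)) (word (m + 1) c) +
        (if word (m + 1) c = [] then 0 else 1) = c.leftLeaves := by
      rcases eq_or_ne c leaf with rfl | hc
      · simp [word, leftLeaves]
      · simp [word_eq_nil, hc, ihc (m + 1) hc]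
    simp only [hb, Bool.toNat_true, hc]
    cases a with
    | leaf => simp [word, leftLeaves]; omega
    | node a₁ a₂ a₃ =>
      have := iha (m + 1 + c.size + b.size) (by simp)
      simp [leftLeaves] at this ⊢
      omega

theorem des_word (t : TernaryTree) : ∀ m, t ≠ leaf → des (word m t) + 1 = t.rightLeaves := by
  simp only [des_eq_adj]
  induction t with
  | leaf => simp
  | node a b c iha ihb ihc =>
    intro m _
    rw [word, adj_append_cons, adj_concat (b := true)
      (by intro y hy; have := mem_word.1 hy; simp; omega), ← List.cons_append, adj_append_cons,
      adj_cons (b := false) (u := word (m + 1) c)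
      (by intro y hy; have := mem_word.1 hy; simp; omega)]
    have hb : adj (fun a b => decide (a > b)) ((m + 1) :: word (m + 1 + c.size) b ++ [m + 1])
        = b.rightLeaves := by
      rcases eq_or_ne b leaf with rfl | hb
      · simp [word, rightLeaves]
      · have h := ihb (m + 1 + c.size) hb
        -- Exposing the first letter `z` of the middle block separates the junction on its left, not
        -- a descent, from the one on its right, which is.
        obtain ⟨z, w, hw⟩ := List.exists_cons_of_ne_nil
          (mt word_eq_nil.1 hb : word (m + 1 + c.size) b ≠ [])
        have hz : m + 1 + c.size < z := (mem_word.1 (hw ▸ List.mem_cons_self)).1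
        have := adj_concat (r := fun a b => decide (a > b)) (b := true) (x := m + 1)
          (u := word (m + 1 + c.size) b)
          (by intro y hy; have := mem_word.1 hy; simp; omega)
        rw [hw] at this h ⊢
        simp only [List.cons_append, adj_cons_cons] at this ⊢
        rw [this]
        have : ¬ m + 1 > z := by omega
        simp only [this, decide_false, Bool.false_eq_true, if_false, reduceCtorEq, Bool.toNat_true]
        omega
    have ha : adj (fun a b => decide (a > b)) (word (m + 1 + c.size + b.size) a) +
        (if word (m + 1 + c.size + b.size) a = [] then 0 else 1) = a.rightLeaves := by
      rcases eq_or_ne a leaf with rfl | ha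
      · simp [word, rightLeaves]
      · simp [word_eq_nil, ha, iha _ ha]
    simp only [hb, Bool.toNat_true, ha]
    cases c with
    | leaf => simp [word, rightLeaves]
    | node a₁ a₂ a₃ =>
      have := ihc (m + 1) (by simp)
      simp [rightLeaves] at this ⊢
      omega

theorem plat_word (t : TernaryTree) : ∀ m, plat (word m t) = t.midLeaves := by
  simp only [plat_eq_adj]
  induction t with
  | leaf => simp [word, midLeaves]
  | node a b c iha ihb ihc =>
    intro m
    rw [word, adj_append_cons, adj_concat (b := false)
      (by intro y hy; have := mem_word.1 hy; simp; omega), ← List.cons_append, adj_append_cons,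
      adj_cons (b := false) (u := word (m + 1) c)
      (by intro y hy; have := mem_word.1 hy; simp; omega)]
    simp only [iha, ihc]
    cases b with
    | leaf => simp [word, midLeaves]; omega
    | node b₁ b₂ b₃ =>
      have h := ihb (m + 1 + c.size)
      obtain ⟨z, w, hw⟩ := List.exists_cons_of_ne_nil
        (mt word_eq_nil.1 (by simp) : word (m + 1 + c.size) (node b₁ b₂ b₃) ≠ [])
      have hz : m + 1 + c.size < z := (mem_word.1 (hw ▸ List.mem_cons_self)).1
      have := adj_concat (r := fun a b => decide (a = b)) (b := false) (x := m + 1)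
        (u := word (m + 1 + c.size) (node b₁ b₂ b₃))
        (by intro y hy; have := mem_word.1 hy; simp; omega)
      rw [hw] at this h ⊢
      simp only [List.cons_append, adj_cons_cons] at this ⊢
      have hne : m + 1 ≠ z := by omega
      rw [this, h]
      simp [midLeaves, hne]
      omega

end TernaryTree

/-- Avoidance of the pattern 213 in terms of subwords. -/
def Avoids213 (l : List ℕ) : Prop := ∀ a b c, a < b → b < c → ¬ [b, a, c] <+ l

theorem IsStirling.sublist {l l' : List ℕ} (h : IsStirling l) (hl : l' <+ l) : IsStirling l' :=
  fun a b hs => h a b (hs.trans hl)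

theorem Avoids213.sublist {l l' : List ℕ} (h : Avoids213 l) (hl : l' <+ l) : Avoids213 l' :=
  fun a b c hab hbc hs => h a b c hab hbc (hs.trans hl)

open TernaryTree

/-- Disposes of the case `a = b` in `IsStirling`, where only multiplicities matter. -/
theorem not_triple_sublist_of_count {y : ℕ} {l : List ℕ} (h : l.count y ≤ 2) :
    ¬ [y, y, y] <+ l := fun hs => by
  have := hs.count_le y
  simp at this
  omega

theorem isStirling_word (t : TernaryTree) : ∀ m, IsStirling (word m t) := by
  induction t with
  | leaf => intro m a b h; simp [word] at h
  | node a b c iha ihb ihc =>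
    intro m y z hs
    have h3 : y ≠ z := by
      rintro rfl
      refine not_triple_sublist_of_count ?_ hs
      rw [count_word]
      split_ifs <;> simp
    have h0 := mem_word.1 (mem_of_triple_sublist hs).1
    have h0' := mem_word.1 (mem_of_triple_sublist hs).2.1
    rcases eq_or_ne y (m + 1) with rfl | hy
    · omega
    simp only [word, triple_sublist_append, pair_sublist_append, List.cons_sublist_cons',
      List.singleton_sublist, List.mem_append, List.mem_cons, mem_word] at hs
    have ha := iha (m + 1 + c.size + b.size) y z
    have hb := ihb (m + 1 + c.size) y z
    have hc := ihc (m + 1) y z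
    -- A subword `y z y` meeting several blocks would put `y` in two blocks, whose letter intervals
    -- are disjoint; `k1` to `k4` supply these interval bounds.
    have k1 := fun h =>
      mem_word.1 (mem_of_pair_sublist (a := y) (b := z) (l := word (m + 1 + c.size + b.size) a) h).1
    have k2 := fun h =>
      mem_word.1 (mem_of_pair_sublist (a := z) (b := y) (l := word (m + 1 + c.size) b) h).2
    have k3 := fun h =>
      mem_word.1 (mem_of_pair_sublist (a := y) (b := z) (l := word (m + 1 + c.size) b) h).1
    have k4 := fun h =>
      mem_word.1 (mem_of_pair_sublist (a := z) (b := y) (l := word (m + 1) c) h).2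
    grind

theorem avoids213_word (t : TernaryTree) : ∀ m, Avoids213 (word m t) := by
  induction t with
  | leaf => intro m a b c _ _ h; simp [word] at h
  | node a b c iha ihb ihc =>
    intro m x y z hxy hyz hs
    have h0 := mem_word.1 (mem_of_triple_sublist hs).1
    have h0' := mem_word.1 (mem_of_triple_sublist hs).2.1
    simp only [word, triple_sublist_append, pair_sublist_append, List.cons_sublist_cons',
      List.singleton_sublist, List.mem_append, List.mem_cons, mem_word] at hs
    have ha := iha (m + 1 + c.size + b.size) x y z hxy hyz
    have hb := ihb (m + 1 + c.size) x y z hxy hyz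
    have hc := ihc (m + 1) x y z hxy hyz
    have k1 := fun h =>
      mem_word.1 (mem_of_pair_sublist (a := y) (b := x) (l := word (m + 1 + c.size + b.size) a) h).1
    have k2 := fun h =>
      mem_word.1 (mem_of_pair_sublist (a := x) (b := z) (l := word (m + 1 + c.size) b) h).2
    have k3 := fun h =>
      mem_word.1 (mem_of_pair_sublist (a := y) (b := x) (l := word (m + 1 + c.size) b) h).1
    have k4 := fun h =>
      mem_word.1 (mem_of_pair_sublist (a := x) (b := z) (l := word (m + 1) c) h).2
    grind

/-- With `V` entirely below `U`, the maximum `M` of `V` is the cut: letters up to `M` cannot lie in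
`U`, and those above cannot lie in `V`. -/
theorem exists_count_split {m n : ℕ} {U V : List ℕ}
    (hc : ∀ y, (U ++ V).count y = if m < y ∧ y ≤ m + n then 2 else 0)
    (hUV : ∀ u ∈ U, ∀ v ∈ V, v < u) :
    ∃ j k, j + k = n ∧ (∀ y, V.count y = if m < y ∧ y ≤ m + k then 2 else 0) ∧
      ∀ y, U.count y = if m + k < y ∧ y ≤ m + k + j then 2 else 0 := by
  simp only [List.count_append] at hc
  rcases eq_or_ne V [] with rfl | hV
  · exact ⟨n, 0, by simp, by intro y; simp, by simpa using hc⟩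
  · obtain ⟨M, hM, hmax⟩ := Finset.exists_max_image V.toFinset id (by simpa using hV)
    simp only [List.mem_toFinset, id] at hM hmax
    have hM' : 0 < V.count M := List.count_pos_iff.2 hM
    have h1 := hc M
    have hr : m < M ∧ M ≤ m + n := by
      by_contra h
      rw [if_neg h] at h1
      omega
    have hle : ∀ y, M < y → V.count y = 0 := fun y hy =>
      List.count_eq_zero.2 fun hmem => absurd (hmax y hmem) (by omega)
    have hge : ∀ y, y ≤ M → U.count y = 0 := fun y hy =>
      List.count_eq_zero.2 fun hmem => absurd (hUV y hmem M hM) (by omega)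
    refine ⟨m + n - M, M - m, by omega, fun y => ?_, fun y => ?_⟩
    · have := hc y
      rcases le_or_gt y M with h | h
      · rw [hge y h] at this
        split_ifs at * <;> omega
      · rw [hle y h]
        split_ifs <;> omega
    · have := hc y
      rcases le_or_gt y M with h | h
      · rw [hge y h]
        split_ifs <;> omega
      · rw [hle y h] at this
        split_ifs at * <;> omega

theorem exists_split_of_count_eq_two {x : ℕ} {l : List ℕ} (h : l.count x = 2) :
    ∃ A B C, l = A ++ x :: (B ++ x :: C) ∧ x ∉ A ∧ x ∉ B ∧ x ∉ C := by
  obtain ⟨A, R, rfl, hA⟩ := List.eq_append_cons_of_mem (List.count_pos_iff.1 (h ▸ two_pos))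
  have hR : R.count x = 1 := by
    simp [List.count_eq_zero.2 hA] at h; omega
  obtain ⟨B, C, rfl, hB⟩ := List.eq_append_cons_of_mem (List.count_pos_iff.1 (hR ▸ one_pos))
  refine ⟨A, B, C, rfl, hA, hB, ?_⟩
  simp [List.count_eq_zero.2 hB] at hR
  exact List.count_eq_zero.1 hR

theorem exists_word_eq (n : ℕ) : ∀ m l, (∀ y, l.count y = if m < y ∧ y ≤ m + n then 2 else 0) →
    IsStirling l → Avoids213 l → ∃ t : TernaryTree, t.size = n ∧ word m t = l := by
  induction n using Nat.strong_induction_on with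
  | _ n ih =>
    intro m l hc hst hav
    rcases Nat.eq_zero_or_pos n with rfl | hn
    · refine ⟨leaf, rfl, ?_⟩
      symm
      rw [word, List.eq_nil_iff_forall_not_mem]
      intro y hy
      have := List.count_pos_iff.2 hy
      rw [hc] at this
      split_ifs at this <;> omega
    obtain ⟨A, B, C, rfl, hA, hB, hC⟩ := exists_split_of_count_eq_two (x := m + 1)
      (l := l) (by rw [hc, if_pos]; omega)
    have hgt : ∀ y ∈ A ++ (B ++ C), m + 1 < y := by
      intro y hy
      have hne : y ≠ m + 1 := by rintro rfl; simp_all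
      have := hc y
      have hp : 0 < (A ++ (m + 1) :: (B ++ (m + 1) :: C)).count y := by
        rw [List.count_pos_iff]; simp at hy ⊢; tauto
      split_ifs at this <;> omega
    have hc' : ∀ y, (A ++ (B ++ C)).count y =
        if m + 1 < y ∧ y ≤ m + 1 + (n - 1) then 2 else 0 := by
      intro y
      have := hc y
      simp only [List.count_append, List.count_cons, beq_iff_eq] at this ⊢
      by_cases hy : y = m + 1
      · subst hy
        rw [List.count_eq_zero.2 hA, List.count_eq_zero.2 hB, List.count_eq_zero.2 hC]
        simp
      · rw [if_neg (Ne.symm hy)] at this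
        split_ifs at * <;> omega
    -- `y (m+1) y` violates the Stirling condition. Quantifying over `s` and `t` covers both the cut
    -- `A | B C` and the cut `B | C`.
    have hdis : ∀ y, m + 1 < y → ∀ s t : List ℕ, s ++ (m + 1) :: t <+
        A ++ (m + 1) :: (B ++ (m + 1) :: C) → y ∈ s → y ∈ t → False := by
      intro y hy s t hsub hs ht
      have h : [y, m + 1, y] <+ s ++ (m + 1) :: t := by
        rw [triple_sublist_append]
        simp [hs, ht]
      have := hst _ _ (h.trans hsub)
      omega
    have hle : ∀ y z, m + 1 < y → ∀ s t : List ℕ, s ++ (m + 1) :: t <+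
        A ++ (m + 1) :: (B ++ (m + 1) :: C) → y ∈ s → z ∈ t → z ≤ y := by
      intro y z hy s t hsub hs ht
      by_contra! hyz
      have h : [y, m + 1, z] <+ s ++ (m + 1) :: t := by
        rw [triple_sublist_append]
        simp [hs, ht]
      exact hav _ _ _ hy hyz (h.trans hsub)
    have hs1 : A ++ (m + 1) :: (B ++ C) <+ A ++ (m + 1) :: (B ++ (m + 1) :: C) := by simp
    have hs2 : B ++ (m + 1) :: C <+ A ++ (m + 1) :: (B ++ (m + 1) :: C) :=
      (List.sublist_cons_self _ _).trans (List.sublist_append_right _ _)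
    have hlt : ∀ s t : List ℕ, s ++ (m + 1) :: t <+
        A ++ (m + 1) :: (B ++ (m + 1) :: C) → (∀ y ∈ s, m + 1 < y) →
        ∀ u ∈ s, ∀ v ∈ t, v < u := fun s t hsub hs u hu v hv =>
      lt_of_le_of_ne (hle u v (hs u hu) s t hsub hu hv)
        fun h => hdis u (hs u hu) s t hsub hu (h ▸ hv)
    obtain ⟨i, r, hir, hcr, hci⟩ := exists_count_split hc'
      (hlt _ _ hs1 fun y hy => hgt y (by simp [hy]))
    obtain ⟨j, k, hjk, hck, hcj⟩ := exists_count_split hcr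
      (hlt _ _ hs2 fun y hy => hgt y (by simp [hy]))
    have hsA : A <+ A ++ (m + 1) :: (B ++ (m + 1) :: C) := List.sublist_append_left _ _
    have hsB := (List.sublist_append_left B _).trans hs2
    have hsC := ((List.sublist_cons_self _ _).trans (List.sublist_append_right B _)).trans hs2
    obtain ⟨c, rfl, rfl⟩ := ih k (by omega) _ _ hck (hst.sublist hsC) (hav.sublist hsC)
    obtain ⟨b, rfl, rfl⟩ := ih j (by omega) _ _ hcj (hst.sublist hsB) (hav.sublist hsB)
    obtain ⟨a, rfl, rfl⟩ := ih i (by omega) (m + 1 + c.size + b.size) A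
      (by intro y; rw [hci, ← hjk]; congr 2 <;> grind)
      (hst.sublist hsA) (hav.sublist hsA)
    exact ⟨node a b c, by simp only [size]; omega, rfl⟩

/-! ### Equidistribution on 213-avoiding words via tree symmetries -/

theorem mem_stirlingAvoiding_213 {n : ℕ} {l : List ℕ} :
    l ∈ stirlingAvoiding n ![2, 1, 3] ↔
      (∀ y, l.count y = if 0 < y ∧ y ≤ n then 2 else 0) ∧ IsStirling l ∧ Avoids213 l := by
  rw [mem_stirlingAvoiding, perm_doubledWord_iff, stirlingCondition_iff, containsPattern_213_iff,
    and_assoc]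
  simp only [Avoids213]
  push Not
  rfl

theorem bijOn_word (n : ℕ) : Set.BijOn (word 0) {t | t.size = n}
    (stirlingAvoiding n ![2, 1, 3] : Finset (List ℕ)) := by
  refine ⟨?_, fun t _ t' _ h => word_injective t 0 t' h, ?_⟩
  · rintro t rfl
    rw [Finset.mem_coe, mem_stirlingAvoiding_213]
    exact ⟨fun y => by rw [count_word, zero_add], isStirling_word t 0, avoids213_word t 0⟩
  · intro l hl
    rw [Finset.mem_coe, mem_stirlingAvoiding_213] at hl
    obtain ⟨t, ht⟩ := exists_word_eq n 0 l (by simpa using hl.1) hl.2.1 hl.2.2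
    exact ⟨t, ht⟩

/-- Using `finsum` removes the need to enumerate the trees of a given size; finiteness comes through
the bijection with words. -/
theorem sum_stirlingAvoiding_213 {R : Type*} [AddCommMonoid R] (n : ℕ) (f : List ℕ → R) :
    ∑ σ ∈ stirlingAvoiding n ![2, 1, 3], f σ =
      ∑ᶠ t ∈ {t : TernaryTree | t.size = n}, f (word 0 t) := by
  rw [finsum_mem_eq_of_bijOn (word 0) (bijOn_word n) (g := f) fun _ _ => rfl,
    finsum_mem_coe_finset]

theorem finsum_size_eq {R : Type*} [AddCommMonoid R] (n : ℕ) {f g : TernaryTree → R}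
    {e : TernaryTree → TernaryTree} (he : ∀ t, e (e t) = t) (hs : ∀ t, (e t).size = t.size)
    (hfg : ∀ t, t.size = n → f t = g (e t)) :
    ∑ᶠ t ∈ {t : TernaryTree | t.size = n}, f t = ∑ᶠ t ∈ {t : TernaryTree | t.size = n}, g t :=
  finsum_mem_eq_of_bijOn e ⟨fun t ht => (hs t).trans ht,
    (Function.Involutive.injective he).injOn, fun t ht => ⟨e t, (hs t).trans ht, he t⟩⟩ hfg

theorem ne_leaf_of_size_eq {n : ℕ} (hn : 1 ≤ n) {t : TernaryTree} (ht : t.size = n) :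
    t ≠ leaf := by
  rintro rfl
  simp [size] at ht
  omega

theorem sum_asc_eq_sum_des_213 {n : ℕ} (hn : 1 ≤ n) {R : Type*} [AddCommMonoid R] (f : ℕ → R) :
    ∑ σ ∈ stirlingAvoiding n ![2, 1, 3], f (asc σ + 1) =
      ∑ σ ∈ stirlingAvoiding n ![2, 1, 3], f (des σ + 1) := by
  rw [sum_stirlingAvoiding_213, sum_stirlingAvoiding_213]
  refine finsum_size_eq n swapLR_swapLR size_swapLR fun t ht => ?_
  rw [asc_word t 0 (ne_leaf_of_size_eq hn ht),
    des_word _ 0 (ne_leaf_of_size_eq hn ((size_swapLR t).trans ht)), rightLeaves_swapLR]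

theorem sum_des_eq_sum_plat_213 {n : ℕ} (hn : 1 ≤ n) {R : Type*} [AddCommMonoid R] (f : ℕ → R) :
    ∑ σ ∈ stirlingAvoiding n ![2, 1, 3], f (des σ + 1) =
      ∑ σ ∈ stirlingAvoiding n ![2, 1, 3], f (plat σ) := by
  rw [sum_stirlingAvoiding_213, sum_stirlingAvoiding_213]
  symm
  refine finsum_size_eq n swapMR_swapMR size_swapMR fun t ht => ?_
  rw [plat_word t 0,
    des_word _ 0 (ne_leaf_of_size_eq hn ((size_swapMR t).trans ht)), rightLeaves_swapMR]

end StirlingPerm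

namespace StirlingPerm

open scoped List Polynomial
open Polynomial

/-! ### Initial weakly decreasing runs -/

/-- The length of the longest weakly decreasing prefix. -/
def run : List ℕ → ℕ
  | [] => 0
  | [_] => 1
  | a :: b :: l => if b ≤ a then run (b :: l) + 1 else 1

theorem run_cons_pos (a : ℕ) (l : List ℕ) : 1 ≤ run (a :: l) := by
  cases l with
  | nil => simp [run]
  | cons b l => simp only [run]; split_ifs <;> omega

theorem run_le_length (l : List ℕ) : run l ≤ l.length := by
  induction l with
  | nil => simp [run]
  | cons a l ih =>
    cases l with
    | nil => simp [run]
    | cons b l => simp only [run, List.length_cons] at ih ⊢; split_ifs <;> omega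

theorem length_le_run_append_iff {u v : List ℕ} :
    u.length ≤ run (u ++ v) ↔ u.IsChain (· ≥ ·) := by
  induction u with
  | nil => simp
  | cons a u ih =>
    cases u with
    | nil => simpa using run_cons_pos a v
    | cons b u =>
      rw [List.isChain_cons_cons, ← ih]
      simp only [List.cons_append, run, List.length_cons]
      split_ifs with h <;> simp [h]

theorem run_append_cons {u v : List ℕ} {x : ℕ} (hne : u ≠ []) (hu : u.IsChain (· ≥ ·))
    (hx : ∀ y ∈ u, y < x) : run (u ++ x :: v) = u.length := by
  refine le_antisymm ?_ (length_le_run_append_iff.2 hu)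
  by_contra! h
  have h' : (u ++ [x]).length ≤ run ((u ++ [x]) ++ v) := by simpa using h
  rw [length_le_run_append_iff, List.isChain_iff_pairwise, List.pairwise_append] at h'
  obtain ⟨a, u, rfl⟩ := List.exists_cons_of_ne_nil hne
  have h1 := h'.2.2 a (by simp) x (by simp)
  have h2 := hx a (by simp)
  omega

theorem run_cons_cons_of_lt {l : List ℕ} {x : ℕ} (hx : ∀ y ∈ l, y < x) :
    run (x :: x :: l) = run l + 2 := by
  cases l with
  | nil => simp [run]
  | cons b l => simp [run, (hx b (by simp)).le]

/-- Every letter occurs exactly twice, and letters between equal letters are larger. -/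
structure IsDoubleStirling (l : List ℕ) : Prop where
  count_eq_two : ∀ y ∈ l, l.count y = 2
  stirling : IsStirling l

namespace IsDoubleStirling

/-- If `b < a`, the second `a` would come later and enclose the smaller letter `b`. -/
theorem head_eq {a b : ℕ} {l : List ℕ} (h : IsDoubleStirling (a :: b :: l)) (hab : b ≤ a) :
    a = b := by
  by_contra hne
  have h2 := h.count_eq_two a (by simp)
  rw [List.count_cons_self, List.count_cons_of_ne (Ne.symm hne)] at h2
  have ha : a ∈ l := List.count_pos_iff.1 (by omega)
  have := h.stirling a b (by simpa [List.cons_sublist_cons'] using ha)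
  omega

theorem notMem_tail {a : ℕ} {l : List ℕ} (h : IsDoubleStirling (a :: a :: l)) :
    a ∉ l := by
  have h2 := h.count_eq_two a (by simp)
  exact List.count_eq_zero.1 (by simpa using h2)

theorem tail_tail {a : ℕ} {l : List ℕ} (h : IsDoubleStirling (a :: a :: l)) :
    IsDoubleStirling l where
  count_eq_two y hy := by
    have hya : a ≠ y := fun e => h.notMem_tail (e ▸ hy)
    have := h.count_eq_two y (by simp [hy])
    simpa [List.count_cons_of_ne hya] using this
  stirling x y hxy := h.stirling x y (hxy.trans ((List.sublist_cons_self _ _).trans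
    (List.sublist_cons_self _ _)))

/-- In the initial weakly decreasing run, plateaus and descents alternate. -/
theorem eq_iff_of_chain {a b : ℕ} {v : List ℕ} : ∀ u : List ℕ,
    IsDoubleStirling (u ++ a :: b :: v) → (u ++ [a, b]).IsChain (· ≥ ·) →
      (a = b ↔ Even u.length)
  | [], h, hc => by simpa using h.head_eq (by simpa using hc)
  | [c], h, hc => by
    simp at hc
    obtain rfl := h.head_eq hc.1
    have := h.notMem_tail
    simp at this
    simp [this]
  | c :: d :: u, h, hc => by
    have hcd : c = d := h.head_eq (by simp at hc; exact hc.1)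
    subst hcd
    rw [eq_iff_of_chain u h.tail_tail (by
      have := hc.tail.tail
      simpa using this)]
    simp [Nat.even_add_one, parity_simps]

end IsDoubleStirling

/-! ### Inserting the two largest letters -/

/-- Insert two copies of `x` at position `p`. -/
def insertTwo (x p : ℕ) (l : List ℕ) : List ℕ := l.take p ++ x :: x :: l.drop p

/-- The factor of the generating function contributed by an insertion at a position `p ≥ 1`
of the initial run of length `L`. The flag says whether the run is the whole word. -/
noncomputable def weight (α β : ℤ[X]) (full : Bool) (L p : ℕ) : ℤ[X] :=
  if p = L ∧ full = false then X else if Even p then β else α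

/-- Generating function of the `k`-fold insertions into a word with initial run `L`. -/
noncomputable def insertionPoly (α β : ℤ[X]) : ℕ → Bool → ℕ → ℤ[X]
  | 0, _, _ => 1
  | k + 1, full, L => X * insertionPoly α β k full (L + 2) +
      ∑ p ∈ Finset.range L, weight α β full L (p + 1) * insertionPoly α β k false (p + 1)

/-! ### Symmetry of the insertion polynomials -/

theorem sum_weight_range_even (α β : ℤ[X]) (f : ℕ → ℤ[X]) (i : ℕ) :
    ∑ p ∈ Finset.range (2 * i), (if Even (p + 1) then β else α) * f (p + 1) =
      ∑ j ∈ Finset.range i, (α * f (2 * j + 1) + β * f (2 * j + 2)) := by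
  induction i with
  | zero => simp
  | succ i ih =>
    rw [Nat.mul_succ, Finset.sum_range_succ, Finset.sum_range_succ, ih, Finset.sum_range_succ]
    have h1 : ¬ Even (2 * i + 1) := by simp
    have h2 : Even (2 * i + 1 + 1) := by simp [parity_simps]
    rw [if_neg h1, if_pos h2]
    ring

section

variable (α β : ℤ[X]) (k i : ℕ)

theorem insertionPoly_succ_odd : insertionPoly α β (k + 1) false (2 * i + 1) =
    X * insertionPoly α β k false (2 * (i + 1) + 1) +
    ∑ j ∈ Finset.range i, (α * insertionPoly α β k false (2 * j + 1) +
      β * insertionPoly α β k false (2 * j + 2)) + X * insertionPoly α β k false (2 * i + 1) := by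
  rw [insertionPoly, Finset.sum_range_succ, ← sum_weight_range_even α β, ← add_assoc]
  congr 2
  · refine Finset.sum_congr rfl fun p hp => ?_
    have := Finset.mem_range.1 hp
    rw [weight, if_neg (by omega)]
  · simp [weight]

theorem insertionPoly_succ_even : insertionPoly α β (k + 1) false (2 * i + 2) =
    X * insertionPoly α β k false (2 * (i + 1) + 2) +
    ∑ j ∈ Finset.range i, (α * insertionPoly α β k false (2 * j + 1) +
      β * insertionPoly α β k false (2 * j + 2)) + α * insertionPoly α β k false (2 * i + 1) +
      X * insertionPoly α β k false (2 * i + 2) := by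
  rw [insertionPoly, Finset.sum_range_succ, Finset.sum_range_succ, ← sum_weight_range_even α β]
  have h1 : weight α β false (2 * i + 2) (2 * i + 1) = α := by simp [weight]
  have h2 : weight α β false (2 * i + 2) (2 * i + 1 + 1) = X := by simp [weight]
  rw [h1, h2, Finset.sum_congr rfl fun p hp => by
    have := Finset.mem_range.1 hp
    rw [weight, if_neg (by omega)]]
  ring_nf

theorem insertionPoly_succ_full : insertionPoly α β (k + 1) true (2 * i) =
    X * insertionPoly α β k true (2 * (i + 1)) +
    ∑ j ∈ Finset.range i, (α * insertionPoly α β k false (2 * j + 1) +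
      β * insertionPoly α β k false (2 * j + 2)) := by
  rw [insertionPoly, ← sum_weight_range_even α β]
  simp [weight, mul_add]

end

/-- For even non-full runs the polynomials themselves are not symmetric (already for `k = 1`, `L =
2`); only the weighted sum over two consecutive lengths is. The recursions involve interior
positions just through these pairs, so the three claims close up under induction. -/
theorem insertionPoly_symm (k : ℕ) :
    (∀ i, insertionPoly X 1 k false (2 * i + 1) = insertionPoly 1 X k false (2 * i + 1)) ∧
    (∀ i, X * insertionPoly X 1 k false (2 * i + 1) + 1 * insertionPoly X 1 k false (2 * i + 2) =
      1 * insertionPoly 1 X k false (2 * i + 1) + X * insertionPoly 1 X k false (2 * i + 2)) ∧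
    ∀ i, insertionPoly X 1 k true (2 * i) = insertionPoly 1 X k true (2 * i) := by
  induction k with
  | zero => simp [insertionPoly, add_comm]
  | succ k ih =>
    obtain ⟨h1, h2, h3⟩ := ih
    refine ⟨fun i => ?_, fun i => ?_, fun i => ?_⟩
    · rw [insertionPoly_succ_odd, insertionPoly_succ_odd, Finset.sum_congr rfl fun j _ => h2 j,
        h1, h1]
    · rw [insertionPoly_succ_odd, insertionPoly_succ_odd, insertionPoly_succ_even,
        insertionPoly_succ_even, Finset.sum_congr rfl fun j _ => h2 j]
      -- After the rewriting, the sum over `j` occurs with total factor `X + 1` on both sides and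
      -- cancels.
      linear_combination X * h2 (i + 1) + X * h2 i + X * h1 i
    · rw [insertionPoly_succ_full, insertionPoly_succ_full, Finset.sum_congr rfl fun j _ => h2 j,
        h3]

/-- Avoidance of the pattern 123 in terms of subwords. -/
def Avoids123 (l : List ℕ) : Prop := ∀ a b c, a < b → b < c → ¬ [a, b, c] <+ l

theorem mem_stirlingAvoiding_123 {n : ℕ} {l : List ℕ} :
    l ∈ stirlingAvoiding n ![1, 2, 3] ↔
      (∀ y, l.count y = if 0 < y ∧ y ≤ n then 2 else 0) ∧ IsStirling l ∧ Avoids123 l := by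
  rw [mem_stirlingAvoiding, perm_doubledWord_iff, stirlingCondition_iff, containsPattern_123_iff,
    and_assoc]
  simp only [Avoids123]
  push Not
  rfl

theorem isDoubleStirling_of_mem {n : ℕ} {l : List ℕ} (h : l ∈ stirlingAvoiding n ![1, 2, 3]) :
    IsDoubleStirling l where
  count_eq_two y hy := by
    have h1 := (mem_stirlingAvoiding_123.1 h).1 y
    have := List.count_pos_iff.2 hy
    split_ifs at h1 <;> omega
  stirling := (mem_stirlingAvoiding_123.1 h).2.1

theorem lt_of_mem {n : ℕ} {l : List ℕ} (h : l ∈ stirlingAvoiding n ![1, 2, 3]) :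
    ∀ y ∈ l, y < n + 1 := fun y hy => by
  have h1 := (mem_stirlingAvoiding_123.1 h).1 y
  have := List.count_pos_iff.2 hy
  split_ifs at h1 <;> omega

theorem length_of_mem {n : ℕ} {l : List ℕ} (h : l ∈ stirlingAvoiding n ![1, 2, 3]) :
    l.length = 2 * n := by
  rw [(mem_stirlingAvoiding.1 h).1.1.length_eq]
  simp [doubledWord, mul_comm]

section

variable {n : ℕ} {u v : List ℕ}

theorem insertion_mem (h : u ++ v ∈ stirlingAvoiding n ![1, 2, 3]) (hu : u.IsChain (· ≥ ·)) :
    u ++ (n + 1) :: (n + 1) :: v ∈ stirlingAvoiding (n + 1) ![1, 2, 3] := by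
  have hlt := lt_of_mem h
  obtain ⟨hc, hst, hav⟩ := mem_stirlingAvoiding_123.1 h
  have hcount : ∀ y, (u ++ (n + 1) :: (n + 1) :: v).count y =
      if 0 < y ∧ y ≤ n + 1 then 2 else 0 := by
    intro y
    have := hc y
    simp only [List.count_append, List.count_cons, beq_iff_eq] at this ⊢
    grind
  have hltu : ∀ y ∈ u, y < n + 1 := fun y hy => hlt y (by simp [hy])
  have hltv : ∀ y ∈ v, y < n + 1 := fun y hy => hlt y (by simp [hy])
  rw [List.isChain_iff_pairwise, List.pairwise_iff_forall_sublist] at hu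
  rw [mem_stirlingAvoiding_123]
  refine ⟨hcount, fun a b hs => ?_, fun a b c hab hbc hs => ?_⟩
  · have hne : a ≠ b := by
      rintro rfl
      have h1 := hs.count_le a
      rw [hcount] at h1
      simp at h1
      split_ifs at h1 <;> omega
    have h1 := hst a b
    rw [triple_sublist_append] at h1
    have k1 := fun h => mem_of_pair_sublist (a := a) (b := b) (l := u) h
    have k2 := fun h => mem_of_pair_sublist (a := b) (b := a) (l := v) h
    simp only [triple_sublist_append, List.cons_sublist_cons', List.singleton_sublist,
      List.mem_cons] at hs
    grind
  · have h1 := hav a b c hab hbc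
    have hu' := fun h => hu (a := a) (b := b) h
    rw [triple_sublist_append] at h1
    have k0 := fun h => mem_of_triple_sublist (a := a) (b := b) (c := c) (l := u) h
    have k1 := fun h => mem_of_pair_sublist (a := a) (b := b) (l := u) h
    have k2 := fun h => mem_of_pair_sublist (a := b) (b := c) (l := v) h
    simp only [triple_sublist_append, List.cons_sublist_cons', List.singleton_sublist,
      List.mem_cons] at hs
    grind

/-- An increasing pair in `u` followed by the maximum `n + 1` would be a 123. -/
theorem mem_of_insertion_mem
    (h : u ++ (n + 1) :: (n + 1) :: v ∈ stirlingAvoiding (n + 1) ![1, 2, 3]) :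
    u ++ v ∈ stirlingAvoiding n ![1, 2, 3] ∧ u.IsChain (· ≥ ·) := by
  obtain ⟨hc, hst, hav⟩ := mem_stirlingAvoiding_123.1 h
  have hsub : u ++ v <+ u ++ (n + 1) :: (n + 1) :: v := by
    rw [List.append_sublist_append_left]
    exact (List.sublist_cons_self _ _).trans (List.sublist_cons_self _ _)
  have hcount : ∀ y, (u ++ v).count y = if 0 < y ∧ y ≤ n then 2 else 0 := by
    intro y
    have := hc y
    simp only [List.count_append, List.count_cons, beq_iff_eq] at this ⊢
    grind
  refine ⟨mem_stirlingAvoiding_123.2 ⟨hcount, fun a b hs => hst a b (hs.trans hsub),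
    fun a b c hab hbc hs => hav a b c hab hbc (hs.trans hsub)⟩, ?_⟩
  rw [List.isChain_iff_pairwise, List.pairwise_iff_forall_sublist]
  intro a b hs
  by_contra! hlt
  have hb := List.count_pos_iff.2 (List.mem_append_left v (mem_of_pair_sublist hs).2)
  rw [hcount] at hb
  refine hav a b (n + 1) hlt (by split_ifs at hb <;> omega) ?_
  rw [triple_sublist_append]
  simp [hs]

end

/-- A letter between the two copies of the maximum would have to exceed it. -/
theorem exists_eq_insertion {n : ℕ} {l : List ℕ}
    (h : l ∈ stirlingAvoiding (n + 1) ![1, 2, 3]) :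
    ∃ u v, l = u ++ (n + 1) :: (n + 1) :: v := by
  obtain ⟨hc, hst, -⟩ := mem_stirlingAvoiding_123.1 h
  have h2 : l.count (n + 1) = 2 := by rw [hc]; simp
  obtain ⟨A, R, rfl, hA⟩ := List.eq_append_cons_of_mem (List.count_pos_iff.1 (h2 ▸ two_pos))
  cases R with
  | nil => simp [List.count_eq_zero.2 hA] at h2
  | cons b R =>
    rcases eq_or_ne b (n + 1) with rfl | hb
    · exact ⟨A, R, rfl⟩
    · have hR : n + 1 ∈ R := by
        rw [← List.count_pos_iff]
        simp [List.count_eq_zero.2 hA, hb] at h2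
        omega
      have := hst (n + 1) b (by
        rw [triple_sublist_append]
        simp [hR])
      have := lt_of_mem h b (by simp)
      omega

theorem sum_stirlingAvoiding_123_succ {R : Type*} [AddCommMonoid R] (n : ℕ) (f : List ℕ → R) :
    ∑ σ ∈ stirlingAvoiding (n + 1) ![1, 2, 3], f σ =
      ∑ τ ∈ stirlingAvoiding n ![1, 2, 3], ∑ p ∈ Finset.range (run τ + 1),
        f (insertTwo (n + 1) p τ) := by
  rw [Finset.sum_sigma']
  symm
  refine Finset.sum_bij (fun x _ => insertTwo (n + 1) x.2 x.1) ?_ ?_ ?_ fun _ _ => rfl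
  · rintro ⟨τ, p⟩ hx
    simp only [Finset.mem_sigma, Finset.mem_range] at hx ⊢
    have hp := run_le_length τ
    refine insertion_mem (by simpa using hx.1) ?_
    rw [← length_le_run_append_iff (v := τ.drop p), List.take_append_drop, List.length_take]
    omega
  · rintro ⟨τ, p⟩ hx ⟨τ', p'⟩ hx' he
    simp only [Finset.mem_sigma, Finset.mem_range] at hx hx'
    have hp := run_le_length τ
    have hp' := run_le_length τ'
    have hn : n + 1 ∉ τ.take p := fun hm =>
      absurd (lt_of_mem hx.1 _ (List.mem_of_mem_take hm)) (by simp)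
    have hn' : n + 1 ∉ τ'.take p' := fun hm =>
      absurd (lt_of_mem hx'.1 _ (List.mem_of_mem_take hm)) (by simp)
    obtain ⟨h1, h2⟩ := append_cons_inj hn hn' he
    simp only [List.cons.injEq, true_and] at h2
    have h3 := congrArg List.length h1
    simp only [List.length_take] at h3 hx hx'
    have h4 : τ = τ' := by rw [← List.take_append_drop p τ, h1, h2, List.take_append_drop]
    subst h4
    have : p = p' := by omega
    rw [this]
  · intro σ hσ
    obtain ⟨u, v, rfl⟩ := exists_eq_insertion hσ
    obtain ⟨h1, h2⟩ := mem_of_insertion_mem hσ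
    refine ⟨⟨u ++ v, u.length⟩, ?_, by simp [insertTwo]⟩
    simp only [Finset.mem_sigma, Finset.mem_range]
    exact ⟨h1, Nat.lt_succ_of_le (length_le_run_append_iff.2 h2)⟩

/-- `stat` behaves under insertion into an initial run according to the weights `α` and `β`. -/
def FollowsWeights (α β : ℤ[X]) (stat : List ℕ → ℕ) : Prop :=
  ∀ u v : List ℕ, ∀ x : ℕ, u ++ v ≠ [] → Even (u ++ v).length → IsDoubleStirling (u ++ v) →
    (∀ y ∈ u ++ v, y < x) → u.IsChain (· ≥ ·) →
      (X : ℤ[X]) ^ stat (u ++ x :: x :: v) = X ^ stat (u ++ v) *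
        if u = [] then X
        else weight α β (decide (run (u ++ v) = (u ++ v).length)) (run (u ++ v)) u.length

theorem adj_insertion {r : ℕ → ℕ → Bool} {b c : Bool} {u v : List ℕ} {x : ℕ}
    (hu : ∀ y ∈ u, r y x = b) (hv : ∀ y ∈ v, r x y = c) :
    adj r (u ++ x :: x :: v) = adj r u + (if u = [] then 0 else b.toNat) + (r x x).toNat +
      (adj r v + if v = [] then 0 else c.toNat) := by
  rw [adj_append_cons, adj_concat hu, adj_cons_cons, adj_cons hv]
  cases r x x
  · simp
  · simp; omega

theorem adj_concat_append_cons (r : ℕ → ℕ → Bool) (u : List ℕ) (a b : ℕ) (v : List ℕ) :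
    adj r ((u ++ [a]) ++ b :: v) = adj r (u ++ [a]) + (r a b).toNat + adj r (b :: v) := by
  rw [List.append_assoc, List.singleton_append, adj_append_cons, adj_cons_cons]
  cases r a b <;> simp [add_assoc]

/-- The relation between the two letters around an insertion position. -/
theorem junction_cases {u v : List ℕ} {a b : ℕ} (h : IsDoubleStirling ((u ++ [a]) ++ b :: v))
    (hu : (u ++ [a]).IsChain (· ≥ ·)) :
    (a < b ∧ run ((u ++ [a]) ++ b :: v) = (u ++ [a]).length) ∨
    (a = b ∧ ¬ Even (u ++ [a]).length ∧ (u ++ [a]).length < run ((u ++ [a]) ++ b :: v)) ∨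
    (b < a ∧ Even (u ++ [a]).length ∧ (u ++ [a]).length < run ((u ++ [a]) ++ b :: v)) := by
  have hiff : (u ++ [a]).length < run ((u ++ [a]) ++ b :: v) ↔ b ≤ a := by
    have h1 := length_le_run_append_iff (u := u ++ [a, b]) (v := v)
    have h2 : (u ++ [a, b]).IsChain (· ≥ ·) ↔ b ≤ a := by
      rw [List.isChain_iff_pairwise] at hu ⊢
      simp [List.pairwise_append] at hu ⊢
      grind
    rw [h2] at h1
    rw [← h1]
    simp
    omega
  have hle : (u ++ [a]).length ≤ run ((u ++ [a]) ++ b :: v) := length_le_run_append_iff.2 hu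
  rcases lt_or_ge a b with hab | hab
  · left
    refine ⟨hab, le_antisymm ?_ hle⟩
    by_contra! hlt
    exact absurd (hiff.1 hlt) (by omega)
  · right
    have hr := hiff.2 hab
    have hch : (u ++ [a, b]).IsChain (· ≥ ·) := by
      rw [← length_le_run_append_iff (v := v)]
      simp at hr ⊢
      omega
    have := IsDoubleStirling.eq_iff_of_chain u (by simpa using h) hch
    rcases hab.eq_or_lt with rfl | hlt
    · left
      simp only [true_iff] at this
      exact ⟨rfl, by simpa [parity_simps] using this, hr⟩
    · right
      refine ⟨hlt, ?_, hr⟩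
      have h' : ¬ Even u.length := fun he => absurd (this.2 he) (by omega)
      simpa [parity_simps] using h'

/-- Here `c` and `d` record whether descents and plateaus are counted. The inserted pair brings a
plateau, a descent if something follows, and perhaps an uncounted ascent, so `c + d = 1` in total
away from the end. Subtracting the destroyed adjacency leaves `1` for an ascent, `c` for a plateau,
`d` for a descent. -/
theorem followsWeights_of_adj {r : ℕ → ℕ → Bool} {α β : ℤ[X]} {c d : Bool} {s : ℕ}
    {stat : List ℕ → ℕ} (hstat : ∀ l, stat l = adj r l + s)
    (hb : ∀ x y, y < x → r y x = false) (hc : ∀ x y, y < x → r x y = c) (hd : ∀ x, r x x = d)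
    (hcd : c.toNat + d.toNat = 1) (hα : (X : ℤ[X]) ^ c.toNat = α)
    (hβ : (X : ℤ[X]) ^ d.toNat = β) : FollowsWeights α β stat := by
  intro u v x hne hev hds hx hu
  have hxu : ∀ y ∈ u, r y x = false := fun y hy => hb x y (hx y (by simp [hy]))
  have hxv : ∀ y ∈ v, r x y = c := fun y hy => hc x y (hx y (by simp [hy]))
  rw [hstat, hstat, adj_insertion hxu hxv, hd]
  rcases List.eq_nil_or_concat' u with rfl | ⟨u, a, rfl⟩
  · rw [List.nil_append] at hne
    simp only [adj_nil, hne, if_true, if_false, List.nil_append]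
    rw [← pow_succ]
    congr 1
    omega
  rw [if_neg (by simp : u ++ [a] ≠ []), if_neg (by simp : u ++ [a] ≠ [])]
  cases v with
  | nil =>
    have hr : run (u ++ [a]) = (u ++ [a]).length :=
      le_antisymm (run_le_length _) (by simpa using length_le_run_append_iff (v := []).2 hu)
    rw [List.append_nil] at hev ⊢
    -- At the end of the word nothing is destroyed and no descent is created, so the gain is `d`;
    -- this agrees with `β` because the length is even.
    rw [if_pos (rfl : ([] : List ℕ) = []), weight, if_neg (by simp [hr]),
      if_pos hev, ← hβ, ← pow_add]
    congr 1
    simp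
    omega
  | cons d v =>
    rw [if_neg (by simp : d :: v ≠ []), adj_concat_append_cons]
    rcases junction_cases hds hu with ⟨h1, h2⟩ | ⟨rfl, h1, h2⟩ | ⟨h1, h2, h3⟩
    · rw [h2, hb _ _ h1, weight, if_pos (by simp), ← pow_succ]
      congr 1
      simp only [Bool.toNat_false]
      omega
    · rw [hd, weight, if_neg (by omega), if_neg h1, ← hα, ← pow_add]
      congr 1
      simp only [Bool.toNat_false]
      omega
    · rw [hc _ _ h1, weight, if_neg (by omega), if_pos h2, ← hβ, ← pow_add]
      congr 1
      simp only [Bool.toNat_false]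
      omega

theorem followsWeights_des : FollowsWeights X 1 fun σ => des σ + 1 :=
  followsWeights_of_adj (c := true) (d := false) (fun l => by rw [des_eq_adj])
    (fun x y h => by simp; omega) (fun x y h => by simpa using h) (fun x => by simp) rfl
    (by simp) (by simp)

theorem followsWeights_plat : FollowsWeights 1 X plat :=
  followsWeights_of_adj (c := false) (d := true) (s := 0) (fun l => by rw [plat_eq_adj, add_zero])
    (fun x y h => by simp; omega) (fun x y h => by simp; omega) (fun x => by simp) rfl
    (by simp) (by simp)

/-- The contribution of all `k`-fold extensions of `τ` depends on `τ` only through its statistic,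
its run and whether the run is everything. The order `n` stays general because the induction inserts
the first pair and applies the hypothesis at `n + 1`. -/
theorem sum_pow_stat {α β : ℤ[X]} {stat : List ℕ → ℕ} (hs : FollowsWeights α β stat) (k : ℕ) :
    ∀ n, 1 ≤ n → ∑ σ ∈ stirlingAvoiding (n + k) ![1, 2, 3], (X : ℤ[X]) ^ stat σ =
      ∑ τ ∈ stirlingAvoiding n ![1, 2, 3],
        X ^ stat τ * insertionPoly α β k (decide (run τ = τ.length)) (run τ) := by
  induction k with
  | zero => intro n _; simp [insertionPoly]
  | succ k ih =>
    intro n hn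
    rw [show n + (k + 1) = (n + 1) + k by omega, ih (n + 1) (by omega),
      sum_stirlingAvoiding_123_succ]
    refine Finset.sum_congr rfl fun τ hτ => ?_
    have hlt := lt_of_mem hτ
    have hlen := length_of_mem hτ
    have hne : τ ≠ [] := by rintro rfl; simp at hlen; omega
    have key : ∀ p ≤ run τ, (X : ℤ[X]) ^ stat (insertTwo (n + 1) p τ) = X ^ stat τ *
        if p = 0 then X else weight α β (decide (run τ = τ.length)) (run τ) p := by
      intro p hp
      have hp' := hp.trans (run_le_length τ)
      have hch : (τ.take p).IsChain (· ≥ ·) := by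
        rw [← length_le_run_append_iff (v := τ.drop p), List.take_append_drop, List.length_take]
        omega
      have := hs (τ.take p) (τ.drop p) (n + 1) (by simpa using hne)
        (by rw [List.take_append_drop, hlen]; simp)
        (by rw [List.take_append_drop]; exact isDoubleStirling_of_mem hτ)
        (by rw [List.take_append_drop]; exact hlt) hch
      simpa [insertTwo, List.length_take, min_eq_left hp', hne] using this
    rw [Finset.sum_range_succ', insertionPoly, add_comm, mul_add, Finset.mul_sum]
    congr 1
    · rw [key 0 (Nat.zero_le _), if_pos rfl, mul_assoc]
      simp only [insertTwo, List.take_zero, List.drop_zero, List.nil_append,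
        run_cons_cons_of_lt hlt, List.length_cons, add_assoc, Nat.reduceAdd,
        Nat.add_right_cancel_iff]
    · refine Finset.sum_congr rfl fun p hp => ?_
      have hp := Finset.mem_range.1 hp
      have hp' := hp.trans_le (run_le_length τ)
      have hch : (τ.take (p + 1)).IsChain (· ≥ ·) := by
        rw [← length_le_run_append_iff (v := τ.drop (p + 1)), List.take_append_drop,
          List.length_take]
        omega
      have hrun : run (insertTwo (n + 1) (p + 1) τ) = p + 1 := by
        rw [insertTwo, run_append_cons (by simp [hne]) hch
          fun y hy => hlt y (List.mem_of_mem_take hy)]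
        simp
        omega
      -- Insertion away from the front creates an ascent, so the new run is never the whole word.
      have hnf : decide (p + 1 = (insertTwo (n + 1) (p + 1) τ).length) = false := by
        simp [insertTwo]
        omega
      rw [key (p + 1) (by omega), hrun, hnf]
      simp [mul_assoc]

theorem stirlingAvoiding_one_123 : stirlingAvoiding 1 ![1, 2, 3] = {[1, 1]} := by
  ext l
  rw [mem_stirlingAvoiding, Finset.mem_singleton]
  have h1 : doubledWord 1 = List.replicate 2 1 := rfl
  rw [h1, List.perm_replicate]
  constructor
  · exact fun h => h.1.1
  · rintro rfl
    refine ⟨⟨rfl, ?_⟩, ?_⟩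
    · intro i j k hij hjk
      have := k.isLt
      simp only [List.length_cons, List.length_nil] at this
      omega
    · rw [containsPattern_123_iff]
      rintro ⟨a, b, c, -, -, h⟩
      simpa using h.length_le

theorem sum_des_eq_sum_plat_123 {n : ℕ} (hn : 1 ≤ n) :
    ∑ σ ∈ stirlingAvoiding n ![1, 2, 3], (X : ℤ[X]) ^ (des σ + 1) =
      ∑ σ ∈ stirlingAvoiding n ![1, 2, 3], X ^ plat σ := by
  obtain ⟨k, rfl⟩ := Nat.exists_eq_add_of_le hn
  rw [sum_pow_stat followsWeights_des k 1 le_rfl, sum_pow_stat followsWeights_plat k 1 le_rfl,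
    stirlingAvoiding_one_123]
  -- The starting word `1 1` is a full run of length `2 * 1`.
  have := (insertionPoly_symm k).2.2 1
  simp [run, des, plat] at this ⊢
  exact this

end StirlingPerm

theorem mainTheorem4 (n : ℕ) (hn : 1 ≤ n) :
    (∑ σ ∈ StirlingPerm.stirlingAvoiding n ![1, 2, 3],
        (Polynomial.X : Polynomial ℤ) ^ (StirlingPerm.des σ + 1)
      = ∑ σ ∈ StirlingPerm.stirlingAvoiding n ![1, 2, 3],
        (Polynomial.X : Polynomial ℤ) ^ StirlingPerm.plat σ) ∧
    (∑ σ ∈ StirlingPerm.stirlingAvoiding n ![2, 1, 3],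
        (Polynomial.X : Polynomial ℤ) ^ (StirlingPerm.asc σ + 1)
      = ∑ σ ∈ StirlingPerm.stirlingAvoiding n ![2, 1, 3],
        (Polynomial.X : Polynomial ℤ) ^ (StirlingPerm.des σ + 1)) ∧
    (∑ σ ∈ StirlingPerm.stirlingAvoiding n ![2, 1, 3],
        (Polynomial.X : Polynomial ℤ) ^ (StirlingPerm.des σ + 1)
      = ∑ σ ∈ StirlingPerm.stirlingAvoiding n ![2, 1, 3],
        (Polynomial.X : Polynomial ℤ) ^ StirlingPerm.plat σ) :=
  ⟨StirlingPerm.sum_des_eq_sum_plat_123 hn, StirlingPerm.sum_asc_eq_sum_des_213 hn _,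
    StirlingPerm.sum_des_eq_sum_plat_213 hn _⟩
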